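/- For a finite graph $G$ with at least one vertex, let $e(G)$ and $|G|$ denote its numbers of edges and vertices, and let $\mathrm{Mad}(G)=\max\{2e(H)/|H| : H\subseteq G \text{ a subgraph with at least one vertex}\}$ be its maximum average degree. A $k$-decomposition of the complete graph $K_n$ is a partition of its edge set into the edge sets of $k$ spanning subgraphs $G_1,\dots,G_k$ (some of which may have no edges). For $k,n\ge 1$ let $$M(k,n)=\max\sum_{i=1}^k \mathrm{Mad}(G_i),$$ the maximum being taken over all $k$-decompositions $(G_1,\dots,G_k)$ of $K_n$. **Theorem.** Let $q$ be a prime power (so $q\ge 2$). 1. If $n=k=q^2+q+1$, then $M(k,n)=(q^2+q+1)q=qk=\frac{2}{q+1}\binom n2$. 2. If $n=q^2$ and $k=q^2+q$, then $M(k,n)=(q+1)q(q-1)=(q-1)k=\frac2q\binom n2$. 3. If $n=q^2+q$ and $k=q^2+q+1$, then $M(k,n)=q^3+q^2-1=qk-q-1$. 4. If $n=q^2-1$ and $k=q^2+q$, then $M(k,n)=q^3-2q-1=(q-1)k-q-1$. 5. If $n=q^2-q$ and $k=q^2+q-1$, then $M(k,n)=q^3-q^2-2q+1=(q-2)k+q-1$.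 -/

import Mathlib

namespace NordhausGaddum

/-- Average degree `d(H) = 2 e(H) / |H|` of a subgraph `H` (meaningful when `H` has a vertex). -/
noncomputable def avgDeg {V : Type*} {G : SimpleGraph V} (H : G.Subgraph) : ℝ :=
  2 * (H.edgeSet.ncard : ℝ) / (H.verts.ncard : ℝ)

/-- The average degrees of all subgraphs of `G` with at least one vertex. -/
def avgDegs {V : Type*} (G : SimpleGraph V) : Set ℝ :=
  {d | ∃ H : G.Subgraph, H.verts.Nonempty ∧ d = avgDeg H}

/-- Maximum average degree `Mad(G) = max {2 e(H) / |H| : H ⊆ G}` of a finite graph. -/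
noncomputable def mad {V : Type*} (G : SimpleGraph V) : ℝ :=
  sSup (avgDegs G)

/-- A decomposition of `G`: a family of spanning subgraphs (graphs on the same vertex set, possibly
without edges) whose edge sets are pairwise disjoint and together make up the edge set of `G`. -/
def IsDecomposition {V ι : Type*} (G : SimpleGraph V) (F : ι → SimpleGraph V) : Prop :=
  (∀ i j, i ≠ j → Disjoint (F i).edgeSet (F j).edgeSet) ∧
    (⋃ i, (F i).edgeSet) = G.edgeSet

/-- The sums `∑ Mad(G_i)` over all decompositions `(G_1, …, G_k)` of `K_n`. -/
def madSums (k n : ℕ) : Set ℝ :=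
  {s | ∃ F : Fin k → SimpleGraph (Fin n),
    IsDecomposition (⊤ : SimpleGraph (Fin n)) F ∧ s = ∑ i, mad (F i)}

/-- `M(k,n)`: the maximum of `∑ Mad(G_i)` over all `k`-decompositions `(G_1, …, G_k)` of `K_n`. -/
noncomputable def M (k n : ℕ) : ℝ :=
  sSup (madSums k n)

/-- On a finite nonempty vertex set the supremum defining `Mad` is a maximum. -/
theorem isGreatest_mad {V : Type*} [Finite V] [Nonempty V] (G : SimpleGraph V) :
    IsGreatest (avgDegs G) (mad G) := by
  have hfin : (avgDegs G).Finite := by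
    refine (Set.finite_range (fun H : G.Subgraph => avgDeg H)).subset ?_
    rintro d ⟨H, -, rfl⟩
    exact ⟨H, rfl⟩
  have hne : (avgDegs G).Nonempty := ⟨_, (⊤ : G.Subgraph), Set.univ_nonempty, rfl⟩
  exact ⟨hne.csSup_mem hfin, fun d hd => le_csSup hfin.bddAbove hd⟩

/-- For `k ≥ 1` the supremum defining `M(k,n)` is a maximum. -/
theorem isGreatest_M (k n : ℕ) (hk : 0 < k) : IsGreatest (madSums k n) (M k n) := by
  have hfin : (madSums k n).Finite := by
    refine (Set.finite_range
      (fun F : Fin k → SimpleGraph (Fin n) => ∑ i, mad (F i))).subset ?_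
    rintro s ⟨F, -, rfl⟩
    exact ⟨F, rfl⟩
  have hne : (madSums k n).Nonempty := by
    refine ⟨_, fun i => if i = ⟨0, hk⟩ then ⊤ else ⊥, ⟨?_, ?_⟩, rfl⟩
    · intro i j hij
      by_cases hi : i = ⟨0, hk⟩
      · have hj : j ≠ ⟨0, hk⟩ := fun h => hij (hi.trans h.symm)
        simp [hj]
      · simp [hi]
    · refine subset_antisymm (Set.iUnion_subset fun i => ?_) ?_
      · exact SimpleGraph.edgeSet_subset_edgeSet.2 le_top
      · refine Set.subset_iUnion_of_subset ⟨0, hk⟩ ?_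
        simp
  exact ⟨hne.csSup_mem hfin, fun d hd => le_csSup hfin.bddAbove hd⟩

end NordhausGaddum

namespace NordhausGaddum

open Finset

/-! Upper bound: for every natural `t`, a graph with `m` edges satisfies `2t·Mad ≤ 2m + t(t-1)`
(`two_mul_mad_le`), with equality for cliques on `t` or `t + 1` vertices. Summing over a
decomposition, where the edge counts add up to `n(n-1)/2`, bounds `M k n` (`two_mul_M_le`). Lower
bound: restrict a projective plane of order `q` to a set of points and discard lines that miss it.
The line traces decompose `K_n` into cliques (`le_M_of_projectivePlane`). In all five cases every
trace has `t` or `t + 1` points, with `t = q` or `t = q - 1`, so the two bounds coincide. -/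

/-! ### Upper bound -/

/-- A subgraph whose vertex set is finite has at most `v (v - 1) / 2` edges. -/
theorem two_mul_ncard_edgeSet_le {V : Type*} [Finite V] {G : SimpleGraph V} (H : G.Subgraph) :
    2 * H.edgeSet.ncard ≤ H.verts.ncard * (H.verts.ncard - 1) := by
  classical
  have := Fintype.ofFinite V
  have hsub : H.edgeSet ⊆ (H.verts.toFinset.offDiag.image Sym2.mk.uncurry : Finset (Sym2 V)) := by
    intro e
    induction e with | h x y =>
    intro h
    have hxy : H.Adj x y := h
    rw [Finset.mem_coe, Finset.mem_image]
    exact ⟨(x, y), by simp [hxy.fst_mem, hxy.snd_mem, hxy.ne], rfl⟩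
  have h := Set.ncard_le_ncard hsub (Finset.finite_toSet _)
  rw [Set.ncard_coe_finset] at h
  have h2 := Sym2.two_mul_card_image_offDiag H.verts.toFinset
  rw [Finset.offDiag_card, ← Set.ncard_eq_toFinset_card'] at h2
  rw [Nat.mul_sub_one]
  grind

/-- The linear bound on `Mad` that is tight for cliques on `t` and on `t + 1` vertices. -/
theorem two_mul_mad_le {V : Type*} [Finite V] [Nonempty V] (G : SimpleGraph V) (t : ℕ) :
    2 * (t : ℝ) * mad G ≤ 2 * (G.edgeSet.ncard : ℝ) + t * (t - 1) := by
  obtain ⟨H, hne, hd⟩ := (isGreatest_mad G).1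
  have hv : 0 < H.verts.ncard := (Set.ncard_pos (Set.toFinite _)).2 hne
  have he : H.edgeSet.ncard ≤ G.edgeSet.ncard :=
    Set.ncard_le_ncard H.edgeSet_subset (Set.toFinite _)
  have hle := two_mul_ncard_edgeSet_le H
  rw [hd, avgDeg]
  generalize H.verts.ncard = v at *
  generalize H.edgeSet.ncard = e at *
  generalize G.edgeSet.ncard = m at *
  obtain ⟨w, rfl⟩ : ∃ w, v = w + 1 := ⟨v - 1, by omega⟩
  have hle' : 2 * (e : ℝ) ≤ (w + 1) * w := by exact_mod_cast hle
  have he' : (e : ℝ) ≤ m := by exact_mod_cast he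
  push_cast
  have hw : (0 : ℝ) < w + 1 := by positivity
  obtain ⟨d, hde⟩ : ∃ d : ℝ, 2 * (e : ℝ) / (w + 1) = d := ⟨_, rfl⟩
  have hde' : 2 * (e : ℝ) = d * (w + 1) := by rw [← hde]; field_simp
  rw [hde]
  have hd0 : 0 ≤ d := by rw [← hde]; positivity
  have hdw : d ≤ w := by
    have : d * (w + 1) ≤ w * (w + 1) := by linarith
    exact le_of_mul_le_mul_right this hw
  -- The expression is affine in `d` on `[0, w]`, so it suffices to check the endpoint selected by
  -- the sign of the slope `w + 1 - 2t`. At `d = w` it equals `(w + 1 - t)(w - t)`, a product of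
  -- consecutive integers; at `d = 0` it is `t(t - 1)`.
  have key : 0 ≤ d * (w + 1) - 2 * t * d + t * (t - 1) := by
    have hint : (0 : ℝ) ≤ (w + 1 - t) * (w - t) := by
      rcases le_or_gt t w with h | h
      · have : (t : ℝ) ≤ w := by exact_mod_cast h
        exact mul_nonneg (by linarith) (by linarith)
      · have : (w : ℝ) + 1 ≤ t := by exact_mod_cast h
        exact mul_nonneg_of_nonpos_of_nonpos (by linarith) (by linarith)
    rcases le_total ((w : ℝ) + 1) (2 * t) with h | h
    · nlinarith [mul_nonneg (sub_nonneg.2 hdw) (sub_nonneg.2 h)]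
    · have h1 : (0 : ℝ) ≤ t * (t - 1) := by
        rcases Nat.eq_zero_or_pos t with rfl | ht
        · simp
        · have : (1 : ℝ) ≤ t := by exact_mod_cast ht
          exact mul_nonneg (by linarith) (by linarith)
      nlinarith [mul_nonneg hd0 (sub_nonneg.2 h)]
  linarith

theorem IsDecomposition.sum_ncard_edgeSet {V ι : Type*} [Finite V] [Fintype ι]
    {G : SimpleGraph V} {F : ι → SimpleGraph V} (hF : IsDecomposition G F) :
    ∑ i, (F i).edgeSet.ncard = G.edgeSet.ncard := by
  classical
  have := Fintype.ofFinite V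
  have h : G.edgeSet.toFinset = univ.biUnion fun i => (F i).edgeSet.toFinset := by
    ext e
    simp [← hF.2]
  rw [Set.ncard_eq_toFinset_card', h, card_biUnion]
  · exact Finset.sum_congr rfl fun i _ => Set.ncard_eq_toFinset_card' _
  · intro i _ j _ hij
    exact Set.disjoint_toFinset.2 (hF.1 i j hij)

theorem two_mul_ncard_edgeSet_top (n : ℕ) :
    2 * ((⊤ : SimpleGraph (Fin n)).edgeSet.ncard : ℝ) = n * (n - 1) := by
  have h : (⊤ : SimpleGraph (Fin n)).edgeSet.ncard = n.choose 2 := by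
    rw [Set.ncard_eq_toFinset_card', ← SimpleGraph.edgeFinset,
      SimpleGraph.card_edgeFinset_top_eq_card_choose_two, Fintype.card_fin]
  rw [h, Nat.cast_choose_two]
  ring

theorem two_mul_M_le {k n : ℕ} (hk : 0 < k) (hn : 0 < n) (t : ℕ) :
    2 * (t : ℝ) * M k n ≤ n * (n - 1) + k * (t * (t - 1)) := by
  have : Nonempty (Fin n) := ⟨⟨0, hn⟩⟩
  obtain ⟨F, hF, hM⟩ := (isGreatest_M k n hk).1
  rw [hM, Finset.mul_sum, ← two_mul_ncard_edgeSet_top, ← hF.sum_ncard_edgeSet]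
  refine (Finset.sum_le_sum fun i _ => two_mul_mad_le (F i) t).trans_eq ?_
  simp [Finset.sum_add_distrib, Finset.mul_sum]

/-! ### Lower bound from linear spaces -/

/-- A graph containing a clique on `B` has `Mad` at least `|B| - 1`. -/
theorem card_sub_one_le_mad {V : Type*} [Finite V] [Nonempty V] {G : SimpleGraph V} (B : Finset V)
    (hB : ∀ x ∈ B, ∀ y ∈ B, x ≠ y → G.Adj x y) : (#B : ℝ) - 1 ≤ mad G := by
  classical
  have := Fintype.ofFinite V
  rcases B.eq_empty_or_nonempty with rfl | hne
  · obtain ⟨H, -, hd⟩ := (isGreatest_mad G).1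
    have : 0 ≤ mad G := by rw [hd, avgDeg]; positivity
    simpa using by linarith
  set H : G.Subgraph := (⊤ : G.Subgraph).induce (B : Set V) with hH
  have hsub : ((B.offDiag.image Sym2.mk.uncurry : Finset (Sym2 V)) : Set (Sym2 V)) ⊆ H.edgeSet := by
    intro e he
    obtain ⟨⟨x, y⟩, hxy, rfl⟩ := Finset.mem_image.1 (Finset.mem_coe.1 he)
    rw [Finset.mem_offDiag] at hxy
    change H.Adj x y
    simp [hH, hxy, hB x hxy.1 y hxy.2.1 hxy.2.2]
  have h := Set.ncard_le_ncard hsub (Set.toFinite _)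
  rw [Set.ncard_coe_finset] at h
  have h2 := Sym2.two_mul_card_image_offDiag B
  rw [Finset.offDiag_card] at h2
  refine le_trans ?_ ((isGreatest_mad G).2 ⟨H, by simpa [hH] using hne, rfl⟩)
  have hv : H.verts.ncard = #B := by simp [hH]
  have hpos : 0 < #B := hne.card_pos
  rw [avgDeg, hv, le_div_iff₀ (by exact_mod_cast hpos)]
  have h3 : #B * #B ≤ 2 * H.edgeSet.ncard + #B := by grind
  have h4 : (#B : ℝ) * #B ≤ 2 * (H.edgeSet.ncard : ℝ) + #B := by exact_mod_cast h3
  linarith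

/-- A linear space with `n` points and `k` lines in which every point lies on `r` lines yields a
decomposition of `K_n` into `k` cliques. -/
theorem le_M_of_linearSpace {P L : Type*} [Fintype P] [Fintype L] (I : P → L → Prop) {k n r : ℕ}
    (hn : 0 < n) (hk : 0 < k) (hP : Fintype.card P = n) (hL : Fintype.card L = k)
    (hI : ∀ p p', p ≠ p' → ∃! l, I p l ∧ I p' l) (hr : ∀ p, Nat.card {l // I p l} = r) :
    (n : ℝ) * r - k ≤ M k n := by
  classical
  have : Nonempty (Fin n) := ⟨⟨0, hn⟩⟩
  let e : Fin n ≃ P := (Fintype.equivFinOfCardEq hP).symm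
  let f : Fin k ≃ L := (Fintype.equivFinOfCardEq hL).symm
  let F : Fin k → SimpleGraph (Fin n) := fun i =>
    { Adj := fun x y => x ≠ y ∧ I (e x) (f i) ∧ I (e y) (f i)
      symm := ⟨fun x y h => ⟨h.1.symm, h.2.2, h.2.1⟩⟩
      loopless := ⟨fun x h => h.1 rfl⟩ }
  have hF : IsDecomposition ⊤ F := by
    refine ⟨fun i j hij => Set.disjoint_left.2 ?_, ?_⟩
    · intro s
      induction s with | h x y =>
      rintro ⟨hxy, hi⟩ ⟨-, hj⟩
      exact hij (f.injective ((hI _ _ (e.injective.ne hxy)).unique hi hj))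
    · ext s
      induction s with | h x y =>
      rw [Set.mem_iUnion]
      constructor
      · rintro ⟨i, hxy, -⟩
        exact hxy
      · intro hxy
        obtain ⟨l, hl, -⟩ := hI _ _ (e.injective.ne (show x ≠ y from hxy))
        refine ⟨f.symm l, hxy, ?_⟩
        simpa using hl
  refine le_trans ?_ ((isGreatest_M k n hk).2 ⟨F, hF, rfl⟩)
  -- Double count the incident point-line pairs.
  have hcount : ∑ i, #{x | I (e x) (f i)} = n * r := by
    have h : ∀ x, #{i | I (e x) (f i)} = r := fun x => by
      rw [← hr (e x), ← Fintype.card_subtype, ← Nat.card_eq_fintype_card]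
      exact Nat.card_congr (f.subtypeEquiv fun _ => Iff.rfl)
    have := Finset.sum_card_bipartiteAbove_eq_sum_card_bipartiteBelow (s := univ) (t := univ)
      fun x i => I (e x) (f i)
    simp only [Finset.bipartiteAbove, Finset.bipartiteBelow, h] at this
    simpa using this.symm
  calc (n : ℝ) * r - k = ∑ i, ((#{x | I (e x) (f i)} : ℝ) - 1) := by
        rw [Finset.sum_sub_distrib, ← Nat.cast_sum, hcount]
        simp
    _ ≤ ∑ i, mad (F i) := Finset.sum_le_sum fun i _ =>
        card_sub_one_le_mad _ fun x hx y hy hxy =>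
          ⟨hxy, (Finset.mem_filter.1 hx).2, (Finset.mem_filter.1 hy).2⟩

open Configuration

/-- Keep the points `S` of a projective plane and delete the lines `R`, none of which meets `S`. -/
theorem le_M_of_projectivePlane {P L : Type*} [Membership P L] [ProjectivePlane P L]
    [Fintype P] [Fintype L] [DecidableEq L] (S : Finset P) (R : Finset L)
    (hSR : ∀ p ∈ S, ∀ l ∈ R, p ∉ l) {k n : ℕ} (hn : 0 < n) (hk : 0 < k) (hS : #S = n)
    (hR : #Rᶜ = k) : (n : ℝ) * (ProjectivePlane.order P L + 1 : ℕ) - k ≤ M k n := by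
  refine le_M_of_linearSpace (P := S) (L := (Rᶜ : Finset L)) (fun p l => p.1 ∈ l.1) hn hk
    (by simpa using hS) (by rw [Fintype.card_coe, hR]) ?_ ?_
  · rintro ⟨p, hp⟩ ⟨p', hp'⟩ hne
    obtain ⟨l, hl, huniq⟩ := HasLines.existsUnique_line P L p p' fun h => hne (Subtype.ext h)
    exact ⟨⟨l, Finset.mem_compl.2 fun h => hSR p hp l h hl.1⟩, hl,
      fun m hm => Subtype.ext (huniq m.1 hm)⟩
  · rintro ⟨p, hp⟩
    rw [← ProjectivePlane.lineCount_eq L p, lineCount]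
    exact Nat.card_congr
      { toFun := fun l => ⟨l.1.1, l.2⟩
        invFun := fun l => ⟨⟨l.1, Finset.mem_compl.2 fun h => hSR p hp _ h l.2⟩, l.2⟩
        left_inv := fun _ => rfl
        right_inv := fun _ => rfl }

/-! ### Projective planes of prime power order -/

/-- The plane over the field with `q` elements, with incidence given by orthogonality in `K³`; hence
points and lines share one type. The order is recovered from the number of points, as `a² + a + 1`
is strictly increasing. -/
theorem exists_projectivePlane {q : ℕ} (hq : IsPrimePow q) :
    ∃ (P : Type) (_ : Fintype P) (_ : Membership P P) (_ : ProjectivePlane P P),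
      ProjectivePlane.order P P = q := by
  classical
  obtain ⟨p, m, hp, hm, rfl⟩ := (isPrimePow_nat_iff q).1 hq
  have : Fact p.Prime := ⟨hp⟩
  let K := GaloisField p m
  have := Fintype.ofFinite K
  let inst := Fintype.ofFinite (Projectivization K (Fin 3 → K))
  refine ⟨Projectivization K (Fin 3 → K), inst, inferInstance, inferInstance, ?_⟩
  have h1 := ProjectivePlane.card_points (Projectivization K (Fin 3 → K))
    (Projectivization K (Fin 3 → K))
  have h2 := Projectivization.card_of_finrank K (Fin 3 → K) (n := 3) (by simp)
  rw [GaloisField.card p m hm.ne', Nat.card_eq_fintype_card, h1] at h2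
  simp only [Finset.sum_range_succ, Finset.sum_range_zero] at h2
  generalize ProjectivePlane.order (Projectivization K (Fin 3 → K))
    (Projectivization K (Fin 3 → K)) = a at h2 ⊢
  generalize p ^ m = b at h2 ⊢
  rcases lt_trichotomy a b with h | h | h
  · nlinarith
  · exact h
  · nlinarith

theorem card_filter_mem {P L : Type*} [Membership P L] [ProjectivePlane P L] [Fintype P]
    [Finite L] (l : L) [DecidablePred fun p : P => p ∈ l] :
    #{p : P | p ∈ l} = ProjectivePlane.order P L + 1 := by
  rw [← ProjectivePlane.pointCount_eq P l, pointCount, Nat.card_eq_fintype_card,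
    Fintype.card_subtype]

theorem card_filter_mem_or_mem {P L : Type*} [Membership P L] [ProjectivePlane P L] [Fintype P]
    [DecidableEq P] [Finite L] {l m : L} (hlm : l ≠ m) [DecidablePred fun p : P => p ∈ l]
    [DecidablePred fun p : P => p ∈ m] :
    #{p : P | p ∈ l ∨ p ∈ m} = 2 * ProjectivePlane.order P L + 1 := by
  have h1 : #{p : P | p ∈ l ∧ p ∈ m} = 1 := by
    obtain ⟨p, hp, hu⟩ := HasPoints.existsUnique_point P L l m hlm
    refine Finset.card_eq_one.2 ⟨p, ?_⟩
    ext x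
    simp only [Finset.mem_filter_univ, Finset.mem_singleton]
    exact ⟨fun h => hu x h, fun h => h ▸ hp⟩
  have := Finset.card_union_add_card_inter ({p : P | p ∈ l} : Finset P) {p : P | p ∈ m}
  rw [← Finset.filter_or, ← Finset.filter_and, h1, card_filter_mem, card_filter_mem] at this
  omega

theorem eq_of_bounds {k n t : ℕ} {x y : ℝ} (hk : 0 < k) (hn : 0 < n) (ht : 0 < t)
    (hlow : x ≤ M k n) (hx : x = y) (hy : (n : ℝ) * (n - 1) + k * (t * (t - 1)) = 2 * t * y) :
    M k n = y := by
  have h := two_mul_M_le hk hn t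
  rw [hy] at h
  exact le_antisymm (le_of_mul_le_mul_left h (by positivity)) (hx ▸ hlow)

end NordhausGaddum

open NordhausGaddum Configuration Finset in
theorem theorem5p2 (q : ℕ) (hq : IsPrimePow q) :
    (∀ n k : ℕ, n = q ^ 2 + q + 1 → k = q ^ 2 + q + 1 →
      NordhausGaddum.M k n = ((q : ℝ) ^ 2 + q + 1) * q ∧
      NordhausGaddum.M k n = (q : ℝ) * k ∧
      NordhausGaddum.M k n = 2 / ((q : ℝ) + 1) * (n.choose 2 : ℝ)) ∧
    (∀ n k : ℕ, n = q ^ 2 → k = q ^ 2 + q →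
      NordhausGaddum.M k n = ((q : ℝ) + 1) * q * ((q : ℝ) - 1) ∧
      NordhausGaddum.M k n = ((q : ℝ) - 1) * k ∧
      NordhausGaddum.M k n = 2 / (q : ℝ) * (n.choose 2 : ℝ)) ∧
    (∀ n k : ℕ, n = q ^ 2 + q → k = q ^ 2 + q + 1 →
      NordhausGaddum.M k n = (q : ℝ) ^ 3 + (q : ℝ) ^ 2 - 1 ∧
      NordhausGaddum.M k n = (q : ℝ) * k - q - 1) ∧
    (∀ n k : ℕ, n = q ^ 2 - 1 → k = q ^ 2 + q →
      NordhausGaddum.M k n = (q : ℝ) ^ 3 - 2 * q - 1 ∧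
      NordhausGaddum.M k n = ((q : ℝ) - 1) * k - q - 1) ∧
    (∀ n k : ℕ, n = q ^ 2 - q → k = q ^ 2 + q - 1 →
      NordhausGaddum.M k n = (q : ℝ) ^ 3 - (q : ℝ) ^ 2 - 2 * q + 1 ∧
      NordhausGaddum.M k n = ((q : ℝ) - 2) * k + q - 1) := by
  classical
  have hq2 : 2 ≤ q := hq.two_le
  obtain ⟨P, _, _, _, hord⟩ := exists_projectivePlane hq
  have hcard : Fintype.card P = q ^ 2 + q + 1 := hord ▸ ProjectivePlane.card_points P P
  have : Nontrivial P := Fintype.one_lt_card_iff_nontrivial.1 (by rw [hcard]; nlinarith)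
  obtain ⟨l, m, hlm⟩ := exists_pair_ne P
  have hq2' : (2 : ℝ) ≤ q := by exact_mod_cast hq2
  have hq0 : (q : ℝ) ≠ 0 := by positivity
  have hqq : 2 * q ≤ q ^ 2 := by nlinarith
  have hline : #{p : P | p ∉ l} = q ^ 2 := by
    have := Finset.card_filter_add_card_filter_not (s := Finset.univ) fun p : P => p ∈ l
    rw [card_filter_mem, hord, Finset.card_univ, hcard] at this
    omega
  have hlines : #{p : P | ¬ (p ∈ l ∨ p ∈ m)} = q ^ 2 - q := by
    have := Finset.card_filter_add_card_filter_not (s := Finset.univ) fun p : P => p ∈ l ∨ p ∈ m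
    rw [card_filter_mem_or_mem hlm, hord, Finset.card_univ, hcard] at this
    omega
  have low := @le_M_of_projectivePlane P P _ _ _ _ _
  rw [hord] at low
  refine ⟨?_, ?_, ?_, ?_, ?_⟩
  · rintro n k hn hk
    have h := low Finset.univ ∅ (by simp) (k := k) (n := n) (by omega) (by omega)
      (by rw [Finset.card_univ, hcard, hn]) (by simp [hcard, hk])
    have hM : M k n = ((q : ℝ) ^ 2 + q + 1) * q :=
      eq_of_bounds (t := q) (by omega) (by omega) (by omega) h
        (by subst hn hk; push_cast; ring) (by subst hn hk; push_cast; ring)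
    refine ⟨hM, ?_, ?_⟩
    · rw [hM, hk]; push_cast; ring
    · rw [hM, Nat.cast_choose_two, hn]; push_cast; field_simp; ring
  · rintro n k hn hk
    have h := low {p : P | p ∉ l} {l} (by simp) (k := k) (n := n) (by omega) (by omega)
      (by rw [hline, hn]) (by rw [Finset.card_compl, hcard, Finset.card_singleton]; omega)
    -- The affine plane: all traces have `q = t + 1` points.
    have hM : M k n = ((q : ℝ) + 1) * q * ((q : ℝ) - 1) :=
      eq_of_bounds (t := q - 1) (by omega) (by omega) (by omega) h
        (by subst hn hk; push_cast; ring)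
        (by subst hn hk; push_cast [Nat.cast_sub (show 1 ≤ q by omega)]; ring)
    refine ⟨hM, ?_, ?_⟩
    · rw [hM, hk]; push_cast; ring
    · rw [hM, Nat.cast_choose_two, hn]; push_cast; field_simp; ring
  · rintro n k hn hk
    -- Here `l` is used as a point. Deleting it leaves traces of `q` or `q + 1` points.
    have h := low {l}ᶜ ∅ (by simp) (k := k) (n := n) (by omega) (by omega)
      (by rw [Finset.card_compl, hcard, Finset.card_singleton]; omega) (by simp [hcard, hk])
    have hM : M k n = (q : ℝ) ^ 3 + (q : ℝ) ^ 2 - 1 :=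
      eq_of_bounds (t := q) (by omega) (by omega) (by omega) h
        (by subst hn hk; push_cast; ring) (by subst hn hk; push_cast; ring)
    refine ⟨hM, ?_⟩
    rw [hM, hk]; push_cast; ring
  · rintro n k hn hk
    obtain ⟨p₀, hp₀⟩ := Finset.card_pos.1 (by rw [hline]; positivity : 0 < #{p : P | p ∉ l})
    -- An affine plane minus a point: traces of `q - 1` or `q` points.
    have h := low (({p : P | p ∉ l} : Finset P).erase p₀) {l} (by simp) (k := k) (n := n)
      (by omega) (by omega) (by rw [Finset.card_erase_of_mem hp₀, hline, hn])
      (by rw [Finset.card_compl, hcard, Finset.card_singleton]; omega)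
    have hn' : (n : ℝ) = q ^ 2 - 1 := by
      rw [hn, Nat.cast_sub (by omega)]; push_cast; ring
    have hM : M k n = (q : ℝ) ^ 3 - 2 * q - 1 :=
      eq_of_bounds (t := q - 1) (by omega) (by omega) (by omega) h
        (by rw [hn', hk]; push_cast; ring)
        (by rw [hn', hk]; push_cast [Nat.cast_sub (show 1 ≤ q by omega)]; ring)
    refine ⟨hM, ?_⟩
    rw [hM, hk]; push_cast; ring
  · rintro n k hn hk
    -- A remaining line keeps `q` points if it passes through the intersection of `l` and `m`, and
    -- `q - 1` otherwise.
    have h := low {p : P | ¬ (p ∈ l ∨ p ∈ m)} {l, m} (by simp) (k := k) (n := n)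
      (by omega) (by omega) (by rw [hlines, hn])
      (by rw [Finset.card_compl, hcard, Finset.card_pair hlm]; omega)
    have hn' : (n : ℝ) = q ^ 2 - q := by
      rw [hn, Nat.cast_sub (by omega)]; push_cast; ring
    have hk' : (k : ℝ) = q ^ 2 + q - 1 := by
      rw [hk, Nat.cast_sub (by omega)]; push_cast; ring
    have hM : M k n = (q : ℝ) ^ 3 - (q : ℝ) ^ 2 - 2 * q + 1 :=
      eq_of_bounds (t := q - 1) (by omega) (by omega) (by omega) h
        (by rw [hn', hk']; push_cast; ring)
        (by rw [hn', hk']; push_cast [Nat.cast_sub (show 1 ≤ q by omega)]; ring)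
    refine ⟨hM, ?_⟩
    rw [hM, hk']; ring
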